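/- Let $\mathcal V=\{1,\dots,n\}$ and let $\mathcal E\subseteq\mathcal V\times\mathcal V$ be the set of links of a directed graph, where $(j,i)\in\mathcal E$ means that node $j$ can receive information from node $i$. Assume that the graph is strongly connected and that $(j,j)\in\mathcal E$ for every $j$. Let $\mathcal D_i^+=|\{l:(l,i)\in\mathcal E\}|$ be the out-degree of $i$, and let $P=[p_{ji}]\in\mathbb R^{n\times n}$ with $p_{ji}=1/\mathcal D_i^+$ if $(j,i)\in\mathcal E$ and $p_{ji}=0$ otherwise. Let $F=[I_n\ I_n\ \cdots\ I_n]\in\mathbb R^{n\times n^2}$ and $\tilde P=[E_1P^T\ E_2P^T\ \cdots\ E_nP^T]^T\in\mathbb R^{n^2\times n}$, where $E_i\in\mathbb R^{n\times n}$ has $(i,i)$ entry $1$ and all other entries $0$. Let $q\in[0,1]$, and on some probability space let the link indicators $x_{ji}[k]$, $(j,i)\in\mathcal E$, $k\ge 0$, be independent with $\Pr\{x_{ji}[k]=1\}=q$ and $\Pr\{x_{ji}[k]=0\}=1-q$; the entries $x_{ji}[k]$ with $(j,i)\notin\mathcal E$ are arbitrary (they have no effect). Let $x_k\in\mathbb R^{n^2}$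 be the vector obtained by stacking the columns of $[x_{ji}[k]]_{j,i}$, let $u\in\mathbb R^{n^2}$ be the all-ones vector, and let $\circ$ be the entrywise product. Given deterministic initial vectors $y_0,z_0\in\mathbb R^n$ with $\sum_{j=1}^n y_0(j)\neq 0$, define $a_0=\tilde P y_0$, $b_0=\tilde P z_0$, and $$a_k=a_{k-1}\circ(u-x_{k-1})+\tilde P y_k\ (k\ge 1),\qquad y_{k+1}=F(a_k\circ x_k)\ (k\ge 0),$$ $$b_k=b_{k-1}\circ(u-x_{k-1})+\tilde P z_k\ (k\ge 1),\qquad z_{k+1}=F(b_k\circ x_k)\ (k\ge 0).$$ Put $\alpha=\dfrac{\sum_{j=1}^n z_0(j)}{\sum_{j=1}^n y_0(j)}$ and $v_k=z_k-\alpha y_k$. Then $\|v_k\|_\infty\to 0$ as $k\to\infty$ almost surely. Furthermore, for every $j$, $v_k(j)\to 0$ as $k\to\infty$ almost surely. -/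

import Mathlib

open MeasureTheory ProbabilityTheory Filter Topology Matrix

namespace RobustRatio

/-- The communication graph on the nodes `Fin n` is given by its set `E` of links, where
`(j, i) ∈ E` means that node `j` can receive information from node `i`. All self-loops are present
and the graph is strongly connected. -/
structure IsCommGraph {n : ℕ} (E : Finset (Fin n × Fin n)) : Prop where
  selfLoop : ∀ j, (j, j) ∈ E
  stronglyConnected : ∀ i j, Relation.ReflTransGen (fun u v => (u, v) ∈ E) i j

/-- The out-degree of node `i`: the number of nodes that can receive information from `i`
(including `i` itself). -/
def outDegree {n : ℕ} (E : Finset (Fin n × Fin n)) (i : Fin n) : ℕ :=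
  (Finset.univ.filter (fun l => (l, i) ∈ E)).card

/-- The weight matrix `P`: the entry `(j, i)` is `1 / outDegree i` if `j` can receive information
from `i`, and `0` otherwise. -/
noncomputable def weight {n : ℕ} (E : Finset (Fin n × Fin n)) : Matrix (Fin n) (Fin n) ℝ :=
  Matrix.of fun j i => if (j, i) ∈ E then 1 / (outDegree E i : ℝ) else 0

/-- The matrix `F = [I I ⋯ I]` of size `n × n²`. Vectors of length `n²` are matrices whose columns
are stacked; their entries are indexed by pairs `(j, i)` (row `j`, column `i`), so that the block
number `i` of `F` consists of the columns `(l, i)`. -/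
def sumMatrix (n : ℕ) : Matrix (Fin n) (Fin n × Fin n) ℝ :=
  Matrix.of fun j e => (1 : Matrix (Fin n) (Fin n) ℝ) j e.1

/-- The matrix `P̃ = [E₁Pᵀ E₂Pᵀ ⋯ EₙPᵀ]ᵀ` of size `n² × n`, where `Eᵢ` has its entry `(i, i)` equal
to `1` and all other entries equal to `0`. Its block number `i` of rows is `(Eᵢ Pᵀ)ᵀ`. -/
noncomputable def stackedWeight {n : ℕ} (E : Finset (Fin n × Fin n)) :
    Matrix (Fin n × Fin n) (Fin n) ℝ :=
  Matrix.of fun e l => (Matrix.single e.2 e.2 (1 : ℝ) * (weight E)ᵀ)ᵀ e.1 l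

/-- The iteration, for a given realisation `x 0, x 1, …` of the vectors of link indicators and the
initial vector `y₀`. The first component of the `k`-th state is `a k`, the second is `y k`, where
`a 0 = P̃ y₀`, `y 0 = y₀`, `y (k + 1) = F (a k ∘ x k)` and
`a (k + 1) = a k ∘ (u - x k) + P̃ y (k + 1)`. Here `∘` is the entrywise product and `u` is the
vector of ones. -/
noncomputable def iterate {n : ℕ} (E : Finset (Fin n × Fin n)) (x : ℕ → Fin n × Fin n → ℝ)
    (y₀ : Fin n → ℝ) : ℕ → (Fin n × Fin n → ℝ) × (Fin n → ℝ)
  | 0 => (stackedWeight E *ᵥ y₀, y₀)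
  | k + 1 =>
    let a := (iterate E x y₀ k).1
    let y := sumMatrix n *ᵥ (a * x k)
    (a * (1 - x k) + stackedWeight E *ᵥ y, y)

/-- The node values `y k` of the iteration with initial vector `y₀`. -/
noncomputable def nodeValue {n : ℕ} (E : Finset (Fin n × Fin n)) (x : ℕ → Fin n × Fin n → ℝ)
    (y₀ : Fin n → ℝ) (k : ℕ) : Fin n → ℝ :=
  (iterate E x y₀ k).2

/-- The link indicators `x k ω (j, i)`, for the links `(j, i) ∈ E` and the times `k`, are
independent random variables that take the value `1` (the packet from `i` to `j` arrives) with
probability `q` and the value `0` (it is dropped) with probability `1 - q`. Nothing is required of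
the entries at pairs which are not links, because they have no effect on the iteration. -/
structure IsIIDLinks {n : ℕ} {Ω : Type*} [MeasurableSpace Ω] (μ : Measure Ω)
    (E : Finset (Fin n × Fin n)) (q : ℝ) (x : ℕ → Ω → Fin n × Fin n → ℝ) : Prop where
  measurable : ∀ k, ∀ e ∈ E, Measurable fun ω => x k ω e
  prob_one : ∀ k, ∀ e ∈ E, μ {ω | x k ω e = 1} = ENNReal.ofReal q
  prob_zero : ∀ k, ∀ e ∈ E, μ {ω | x k ω e = 0} = ENNReal.ofReal (1 - q)
  indep : iIndepFun (fun (s : ℕ × E) ω => x s.1 ω s.2) μ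

end RobustRatio

namespace RobustRatio

/-! ### Algebra of the weight, summing and stacking matrices. -/

variable {n : ℕ} {E : Finset (Fin n × Fin n)}

/-! The iteration is linear in its initial vector, so `v k` is the iteration started at `z₀ - α •
y₀`, whose entries sum to zero. The state on the links, `a k`, keeps its sum, and its ℓ¹ norm never
increases when the indicators are 0 or 1. If all links are active for `m + 1` consecutive steps, `a`
is replaced by `P̃ P^m F a`; for `m` with `P^m` entrywise positive this shrinks the norm by a fixed
factor `c < 1` (`exists_contraction`).

For `q > 0`, the second Borel–Cantelli lemma on disjoint time windows gives infinitely many such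
windows almost surely (`IsIIDLinks.ae_frequently_window`), so the norm of `a k`, which bounds that
of `y (k + 1)`, tends to zero. For `q = 0` nothing ever arrives and the node values vanish from time
1 on. -/

theorem stackedWeight_mulVec (y : Fin n → ℝ) (e : Fin n × Fin n) :
    (stackedWeight E *ᵥ y) e = weight E e.1 e.2 * y e.2 := by
  have h : ∀ l, stackedWeight E e l = if l = e.2 then weight E e.1 e.2 else 0 := by
    intro l
    simp only [stackedWeight, Matrix.of_apply, Matrix.transpose_apply, Matrix.mul_apply,
      Matrix.single_apply]
    rw [Finset.sum_eq_single e.2]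
    · by_cases hl : l = e.2
      · simp [hl]
      · simp [hl, Ne.symm hl]
    · intro b _ hb
      simp [hb.symm]
    · simp
  simp [Matrix.mulVec, dotProduct, h]

theorem sumMatrix_mulVec (a : Fin n × Fin n → ℝ) (j : Fin n) :
    (sumMatrix n *ᵥ a) j = ∑ i, a (j, i) := by
  simp only [Matrix.mulVec, dotProduct, sumMatrix, Matrix.of_apply, Fintype.sum_prod_type]
  rw [Finset.sum_eq_single j]
  · simp
  · intro b _ hb
    simp [hb.symm]
  · simp

theorem sumMatrix_mulVec_stackedWeight_mulVec (y : Fin n → ℝ) :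
    sumMatrix n *ᵥ (stackedWeight E *ᵥ y) = weight E *ᵥ y := by
  ext j
  simp only [sumMatrix_mulVec, stackedWeight_mulVec]
  rfl

theorem weight_eq_zero {e : Fin n × Fin n} (he : e ∉ E) : weight E e.1 e.2 = 0 := by
  simp [weight, he]

theorem weight_nonneg (j i : Fin n) : 0 ≤ weight E j i := by
  simp only [weight, Matrix.of_apply]
  split_ifs <;> positivity

theorem weight_pos {j i : Fin n} (h : (j, i) ∈ E) : 0 < weight E j i := by
  have : 0 < outDegree E i := Finset.card_pos.2 ⟨j, by simp [h]⟩
  simp only [weight, Matrix.of_apply, if_pos h]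
  positivity

theorem sum_weight (hE : IsCommGraph E) (i : Fin n) : ∑ j, weight E j i = 1 := by
  have : 0 < outDegree E i := Finset.card_pos.2 ⟨i, by simp [hE.selfLoop i]⟩
  have h : (outDegree E i : ℝ) ≠ 0 := by positivity
  simp only [weight, Matrix.of_apply]
  rw [← Finset.sum_filter, Finset.sum_const, nsmul_eq_mul]
  exact mul_one_div_cancel h

theorem sum_stackedWeight_mulVec (hE : IsCommGraph E) (y : Fin n → ℝ) :
    ∑ e, (stackedWeight E *ᵥ y) e = ∑ i, y i := by
  simp only [stackedWeight_mulVec, Fintype.sum_prod_type_right, ← Finset.sum_mul,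
    sum_weight hE, one_mul]

theorem sum_abs_stackedWeight_mulVec (hE : IsCommGraph E) (y : Fin n → ℝ) :
    ∑ e, |(stackedWeight E *ᵥ y) e| = ∑ i, |y i| := by
  simp only [stackedWeight_mulVec, abs_mul, abs_of_nonneg (weight_nonneg _ _),
    Fintype.sum_prod_type_right, ← Finset.sum_mul, sum_weight hE, one_mul]

theorem sum_sumMatrix_mulVec (a : Fin n × Fin n → ℝ) :
    ∑ j, (sumMatrix n *ᵥ a) j = ∑ e, a e := by
  simp only [sumMatrix_mulVec, Fintype.sum_prod_type]

theorem sum_abs_sumMatrix_mulVec_le (a : Fin n × Fin n → ℝ) :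
    ∑ j, |(sumMatrix n *ᵥ a) j| ≤ ∑ e, |a e| := by
  simp only [sumMatrix_mulVec, Fintype.sum_prod_type]
  exact Finset.sum_le_sum fun j _ => Finset.abs_sum_le_sum_abs _ _

/-! ### Primitivity of the weight matrix and ℓ¹ contraction. -/

theorem weight_pow_nonneg (m : ℕ) (j i : Fin n) : 0 ≤ (weight E ^ m) j i := by
  induction m generalizing i with
  | zero => simp only [pow_zero, Matrix.one_apply]; split_ifs <;> norm_num
  | succ m ih =>
    rw [pow_succ, Matrix.mul_apply]
    exact Finset.sum_nonneg fun l _ => mul_nonneg (ih l) (weight_nonneg l i)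

theorem weight_pow_succ_pos {m : ℕ} {j l i : Fin n} (h : 0 < (weight E ^ m) j l)
    (hl : (l, i) ∈ E) : 0 < (weight E ^ (m + 1)) j i := by
  rw [pow_succ, Matrix.mul_apply]
  exact Finset.sum_pos' (fun l _ => mul_nonneg (weight_pow_nonneg m j l) (weight_nonneg l i))
    ⟨l, Finset.mem_univ l, mul_pos h (weight_pos hl)⟩

/-- The weight matrix is primitive. -/
theorem exists_weight_pow_pos (hE : IsCommGraph E) : ∃ m, ∀ j i, 0 < (weight E ^ m) j i := by
  -- Self-loops keep a positive entry positive in higher powers, so the largest of the path lengths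
  -- serves all pairs at once.
  have mono : ∀ {j i : Fin n} {m m' : ℕ}, m ≤ m' → 0 < (weight E ^ m) j i →
      0 < (weight E ^ m') j i := by
    intro j i m m' h h0
    induction h with
    | refl => exact h0
    | step _ ih => exact weight_pow_succ_pos ih (hE.selfLoop i)
  have ex : ∀ p : Fin n × Fin n, ∃ m, 0 < (weight E ^ m) p.1 p.2 := by
    rintro ⟨j, i⟩
    induction hE.stronglyConnected j i with
    | refl => exact ⟨0, by simp⟩
    | tail _ h ih =>
      obtain ⟨m, hm⟩ := ih
      exact ⟨m + 1, weight_pow_succ_pos hm h⟩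
  choose f hf using ex
  exact ⟨Finset.univ.sup f, fun j i =>
    mono (Finset.le_sup (f := f) (Finset.mem_univ (j, i))) (hf (j, i))⟩

theorem sum_weight_pow (hE : IsCommGraph E) (m : ℕ) (i : Fin n) :
    ∑ j, (weight E ^ m) j i = 1 := by
  induction m generalizing i with
  | zero => simp [Matrix.one_apply]
  | succ m ih =>
    simp only [pow_succ, Matrix.mul_apply]
    rw [Finset.sum_comm]
    simp only [← Finset.sum_mul, ih, one_mul, sum_weight hE]

/-- A positive column-stochastic matrix contracts the `ℓ¹` norm of vectors with sum zero. -/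
theorem exists_contraction {Q : Matrix (Fin n) (Fin n) ℝ} (hQ : ∀ j i, 0 < Q j i)
    (hsum : ∀ i, ∑ j, Q j i = 1) :
    ∃ c < 1, 0 ≤ c ∧ ∀ b : Fin n → ℝ, ∑ i, b i = 0 → ∑ j, |(Q *ᵥ b) j| ≤ c * ∑ i, |b i| := by
  rcases Nat.eq_zero_or_pos n with rfl | hn
  · exact ⟨0, one_pos, le_rfl, fun b _ => by simp⟩
  have : Nonempty (Fin n) := ⟨⟨0, hn⟩⟩
  -- Subtracting the least entry `δ` from every entry of `Q` does not change `Q *ᵥ b` when `b` sums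
  -- to zero, and leaves a nonnegative matrix with column sums `1 - n * δ`.
  obtain ⟨p, hp⟩ := Finite.exists_min fun p : Fin n × Fin n => Q p.1 p.2
  set δ := Q p.1 p.2
  have hδ : 0 < δ := hQ _ _
  have hle : ∀ j i, δ ≤ Q j i := fun j i => hp (j, i)
  have hcol : ∀ i, ∑ j, (Q j i - δ) = 1 - n * δ := fun i => by
    simp [Finset.sum_sub_distrib, hsum]
  refine ⟨1 - n * δ, by have : (0 : ℝ) < n := by exact_mod_cast hn
                        nlinarith [mul_pos this hδ], ?_, fun b hb => ?_⟩
  · rw [← hcol ⟨0, hn⟩]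
    exact Finset.sum_nonneg fun j _ => sub_nonneg.2 (hle _ _)
  · calc ∑ j, |(Q *ᵥ b) j| = ∑ j, |∑ i, (Q j i - δ) * b i| := by
          simp [Matrix.mulVec, dotProduct, sub_mul, Finset.sum_sub_distrib, ← Finset.mul_sum, hb]
      _ ≤ ∑ j, ∑ i, (Q j i - δ) * |b i| := by
          refine Finset.sum_le_sum fun j _ => (Finset.abs_sum_le_sum_abs _ _).trans_eq ?_
          exact Finset.sum_congr rfl fun i _ => by
            rw [abs_mul, abs_of_nonneg (sub_nonneg.2 (hle j i))]
      _ = (1 - n * δ) * ∑ i, |b i| := by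
          rw [Finset.sum_comm]
          simp only [← Finset.sum_mul, hcol, Finset.mul_sum]

/-! ### Pathwise behaviour of the iteration. -/

theorem iterate_sub_smul (x : ℕ → Fin n × Fin n → ℝ) (z y : Fin n → ℝ) (α : ℝ) (k : ℕ) :
    iterate E x (z - α • y) k = iterate E x z k - α • iterate E x y k := by
  induction k with
  | zero => simp [iterate, Matrix.mulVec_sub, Matrix.mulVec_smul]
  | succ k ih =>
    have h : (iterate E x z k - α • iterate E x y k).1 * x k
        = (iterate E x z k).1 * x k - α • ((iterate E x y k).1 * x k) := by
      ext e; simp; ring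
    simp only [iterate, ih, h, Matrix.mulVec_sub, Matrix.mulVec_smul]
    ext e <;> simp
    ring

/-- This is what makes the arbitrary indicator values off `E` harmless. -/
theorem iterate_fst_eq_zero (x : ℕ → Fin n × Fin n → ℝ) (y₀ : Fin n → ℝ) (k : ℕ)
    {e : Fin n × Fin n} (he : e ∉ E) : (iterate E x y₀ k).1 e = 0 := by
  induction k with
  | zero => simp [iterate, stackedWeight_mulVec, weight_eq_zero he]
  | succ k ih =>
    simp only [iterate, Pi.add_apply, Pi.mul_apply, ih, stackedWeight_mulVec, weight_eq_zero he,
      zero_mul, add_zero]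

/-- What leaves a link is summed at a node and redistributed by a column-stochastic matrix; this
holds for any real `x`. -/
theorem sum_iterate_fst (hE : IsCommGraph E) (x : ℕ → Fin n × Fin n → ℝ) (y₀ : Fin n → ℝ)
    (k : ℕ) : ∑ e, (iterate E x y₀ k).1 e = ∑ i, y₀ i := by
  induction k with
  | zero => exact sum_stackedWeight_mulVec hE y₀
  | succ k ih =>
    simp only [iterate, Pi.add_apply, Finset.sum_add_distrib, sum_stackedWeight_mulVec hE,
      sum_sumMatrix_mulVec]
    rw [← ih, ← Finset.sum_add_distrib]
    exact Finset.sum_congr rfl fun e _ => by simp; ring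

theorem abs_fst_mul {x : ℕ → Fin n × Fin n → ℝ} {k : ℕ}
    (hx : ∀ e ∈ E, x k e = 1 ∨ x k e = 0) (y₀ : Fin n → ℝ) (e : Fin n × Fin n) :
    |(iterate E x y₀ k).1 e * (1 - x k e)| + |(iterate E x y₀ k).1 e * x k e|
      = |(iterate E x y₀ k).1 e| := by
  by_cases he : e ∈ E
  · rcases hx e he with h | h <;> simp [h]
  · simp [iterate_fst_eq_zero x y₀ k he]

theorem sum_abs_nodeValue_succ_le {x : ℕ → Fin n × Fin n → ℝ} {k : ℕ}
    (hx : ∀ e ∈ E, x k e = 1 ∨ x k e = 0) (y₀ : Fin n → ℝ) :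
    ∑ j, |nodeValue E x y₀ (k + 1) j| ≤ ∑ e, |(iterate E x y₀ k).1 e| := by
  refine (sum_abs_sumMatrix_mulVec_le _).trans (Finset.sum_le_sum fun e _ => ?_)
  rw [← abs_fst_mul hx y₀ e]
  exact le_add_of_nonneg_left (abs_nonneg _)

theorem sum_abs_iterate_fst_succ_le (hE : IsCommGraph E) {x : ℕ → Fin n × Fin n → ℝ} {k : ℕ}
    (hx : ∀ e ∈ E, x k e = 1 ∨ x k e = 0) (y₀ : Fin n → ℝ) :
    ∑ e, |(iterate E x y₀ (k + 1)).1 e| ≤ ∑ e, |(iterate E x y₀ k).1 e| := by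
  set a := (iterate E x y₀ k).1
  calc ∑ e, |(iterate E x y₀ (k + 1)).1 e|
      ≤ ∑ e, (|a e * (1 - x k e)| + |(stackedWeight E *ᵥ (sumMatrix n *ᵥ (a * x k))) e|) :=
        Finset.sum_le_sum fun e _ => abs_add_le _ _
    _ ≤ ∑ e, |a e * (1 - x k e)| + ∑ e, |a e * x k e| := by
        rw [Finset.sum_add_distrib, sum_abs_stackedWeight_mulVec hE]
        exact add_le_add_right (sum_abs_sumMatrix_mulVec_le _) _
    _ = ∑ e, |a e| := by
        rw [← Finset.sum_add_distrib]
        exact Finset.sum_congr rfl fun e _ => abs_fst_mul hx y₀ e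

theorem iterate_succ_of_eq_one {x : ℕ → Fin n × Fin n → ℝ} {k : ℕ}
    (hx : ∀ e ∈ E, x k e = 1) (y₀ : Fin n → ℝ) :
    (iterate E x y₀ (k + 1)).1 = stackedWeight E *ᵥ (sumMatrix n *ᵥ (iterate E x y₀ k).1) := by
  have h1 : (iterate E x y₀ k).1 * x k = (iterate E x y₀ k).1 := by
    ext e
    by_cases he : e ∈ E
    · simp [hx e he]
    · simp [iterate_fst_eq_zero x y₀ k he]
  simp only [iterate, mul_sub, h1, mul_one, sub_self, zero_add]

/-- Each step applies `P̃ F`, and `F P̃ = P`, so `m + 1` steps collapse to `m` powers of `P`. -/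
theorem iterate_of_forall_eq_one {x : ℕ → Fin n × Fin n → ℝ} {k m : ℕ}
    (hx : ∀ t ≤ m, ∀ e ∈ E, x (k + t) e = 1) (y₀ : Fin n → ℝ) :
    (iterate E x y₀ (k + m + 1)).1
      = stackedWeight E *ᵥ ((weight E ^ m) *ᵥ (sumMatrix n *ᵥ (iterate E x y₀ k).1)) := by
  induction m with
  | zero => simpa using iterate_succ_of_eq_one (hx 0 le_rfl) y₀
  | succ m ih =>
    rw [iterate_succ_of_eq_one (hx (m + 1) le_rfl), ← add_assoc,
      ih fun t ht => hx t (ht.trans m.le_succ), sumMatrix_mulVec_stackedWeight_mulVec,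
      Matrix.mulVec_mulVec _ (weight E), ← pow_succ']

/-- The limit `L ≥ 0` exists by monotonicity and inherits `L ≤ c * L`. -/
theorem tendsto_zero_of_antitone_of_frequently_le {S : ℕ → ℝ} (hS : Antitone S)
    (h0 : ∀ k, 0 ≤ S k) {c : ℝ} (hc : c < 1) {N : ℕ} (h : ∃ᶠ k in atTop, S (k + N) ≤ c * S k) :
    Tendsto S atTop (𝓝 0) := by
  have hlim := tendsto_atTop_ciInf hS ⟨0, by rintro _ ⟨k, rfl⟩; exact h0 k⟩
  set L := ⨅ k, S k
  have hL : 0 ≤ L := ge_of_tendsto' hlim h0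
  have hle : L ≤ c * L := le_of_tendsto_of_tendsto_of_frequently
    ((tendsto_add_atTop_iff_nat N).2 hlim) (hlim.const_mul c) h
  have : L = 0 := by nlinarith
  rwa [this] at hlim

/-- For a realisation in which all links are infinitely often simultaneously active during a time
window of sufficient length, the node values tend to zero if their initial sum vanishes. -/
theorem exists_window_tendsto_nodeValue (hE : IsCommGraph E) :
    ∃ m, ∀ (x : ℕ → Fin n × Fin n → ℝ), (∀ k, ∀ e ∈ E, x k e = 1 ∨ x k e = 0) →
      (∃ᶠ k in atTop, ∀ t ≤ m, ∀ e ∈ E, x (k + t) e = 1) →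
      ∀ y₀ : Fin n → ℝ, ∑ i, y₀ i = 0 → Tendsto (nodeValue E x y₀) atTop (𝓝 0) := by
  obtain ⟨m, hm⟩ := exists_weight_pow_pos hE
  obtain ⟨c, hc, hc0, hQ⟩ := exists_contraction hm (sum_weight_pow hE m)
  refine ⟨m, fun x hx hwin y₀ hy₀ => ?_⟩
  have hS : Tendsto (fun k => ∑ e, |(iterate E x y₀ k).1 e|) atTop (𝓝 0) := by
    refine tendsto_zero_of_antitone_of_frequently_le (N := m + 1)
      (antitone_nat_of_succ_le fun k => sum_abs_iterate_fst_succ_le hE (hx k) y₀)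
      (fun k => Finset.sum_nonneg fun e _ => abs_nonneg _) hc (hwin.mono fun k hk => ?_)
    rw [← add_assoc, iterate_of_forall_eq_one hk, sum_abs_stackedWeight_mulVec hE]
    refine (hQ _ ?_).trans (mul_le_mul_of_nonneg_left (sum_abs_sumMatrix_mulVec_le _) hc0)
    rw [sum_sumMatrix_mulVec, sum_iterate_fst hE, hy₀]
  rw [← tendsto_add_atTop_iff_nat 1]
  refine tendsto_pi_nhds.2 fun j => squeeze_zero_norm (fun k => ?_) hS
  exact (Finset.single_le_sum (f := fun j => |nodeValue E x y₀ (k + 1) j|)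
    (fun j _ => abs_nonneg _) (Finset.mem_univ j)).trans (sum_abs_nodeValue_succ_le (hx k) y₀)

theorem tendsto_nodeValue_of_forall_eq_zero {x : ℕ → Fin n × Fin n → ℝ}
    (hx : ∀ k, ∀ e ∈ E, x k e = 0) (y₀ : Fin n → ℝ) :
    Tendsto (nodeValue E x y₀) atTop (𝓝 0) := by
  rw [← tendsto_add_atTop_iff_nat 1]
  refine tendsto_const_nhds.congr fun k => ?_
  have h : (iterate E x y₀ k).1 * x k = 0 := by
    ext e
    by_cases he : e ∈ E
    · simp [hx k e he]
    · simp [iterate_fst_eq_zero x y₀ k he]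
  simp [nodeValue, iterate, h]

/-! ### Almost sure occurrence of fully active windows. -/

section Probability

variable {Ω : Type*} [MeasurableSpace Ω] {μ : Measure Ω} {q : ℝ}
  {x : ℕ → Ω → Fin n × Fin n → ℝ}

theorem IsIIDLinks.ae_eq_one_or_eq_zero [IsProbabilityMeasure μ]
    (hx : IsIIDLinks μ E q x) (hq₀ : 0 ≤ q) (hq₁ : q ≤ 1) :
    ∀ᵐ ω ∂μ, ∀ k, ∀ e ∈ E, x k ω e = 1 ∨ x k ω e = 0 := by
  refine ae_all_iff.2 fun k => (ae_ball_iff E.countable_toSet).2 fun e he => ?_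
  have h1 : MeasurableSet {ω | x k ω e = 1} := hx.measurable k e he (measurableSet_singleton 1)
  have h0 : MeasurableSet {ω | x k ω e = 0} := hx.measurable k e he (measurableSet_singleton 0)
  have hd : Disjoint {ω | x k ω e = 1} {ω | x k ω e = 0} :=
    Set.disjoint_left.2 fun ω h h' => one_ne_zero (h.symm.trans h')
  refine (prob_compl_eq_zero_iff (h1.union h0)).2 ?_
  rw [measure_union hd h0, hx.prob_one k e he, hx.prob_zero k e he,
    ← ENNReal.ofReal_add hq₀ (sub_nonneg.2 hq₁)]
  simp

theorem IsIIDLinks.ae_eq_zero [IsProbabilityMeasure μ]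
    (hx : IsIIDLinks μ E 0 x) :
    ∀ᵐ ω ∂μ, ∀ k, ∀ e ∈ E, x k ω e = 0 := by
  refine ae_all_iff.2 fun k => (ae_ball_iff E.countable_toSet).2 fun e he => ?_
  refine (prob_compl_eq_zero_iff (hx.measurable k e he (measurableSet_singleton 0))).2 ?_
  exact (hx.prob_zero k e he).trans (by simp)

/-- The probability that all links in a finite set of pairs of a time and a link are active. -/
theorem IsIIDLinks.measure_biInter (hx : IsIIDLinks μ E q x) (S : Finset (ℕ × E)) :
    μ (⋂ s ∈ S, {ω | x s.1 ω s.2 = 1}) = ENNReal.ofReal q ^ S.card := by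
  have h := hx.indep.measure_inter_preimage_eq_mul S (sets := fun _ => {1})
    fun _ _ => measurableSet_singleton 1
  refine h.trans ?_
  rw [← Finset.prod_const]
  exact Finset.prod_congr rfl fun s _ => hx.prob_one s.1 s.2 s.2.2

theorem IsIIDLinks.ae_frequently_window [IsProbabilityMeasure μ]
    (hx : IsIIDLinks μ E q x) (hq : 0 < q) (m : ℕ) :
    ∀ᵐ ω ∂μ, ∃ᶠ k in atTop, ∀ t ≤ m, ∀ e ∈ E, x (k + t) ω e = 1 := by
  classical
  -- Consecutive blocks of `m + 1` times: disjointness makes the events `A r` independent.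
  let B : ℕ → Finset (ℕ × E) := fun r =>
    (Finset.Ico (r * (m + 1)) (r * (m + 1) + (m + 1))) ×ˢ Finset.univ
  have hB : ∀ r, (B r).card = (m + 1) * Fintype.card E := fun r => by
    simp [B, Finset.card_product]
  have hdisj : ∀ r r', r ≠ r' → Disjoint (B r) (B r') := by
    intro r r' hr
    refine Finset.disjoint_left.2 fun s h h' => hr ?_
    simp only [B, Finset.mem_product, Finset.mem_Ico, Finset.mem_univ, and_true] at h h'
    rw [← Nat.div_eq_of_lt_le (n := m + 1) (k := r) h.1 (by rw [Nat.succ_mul]; exact h.2),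
      ← Nat.div_eq_of_lt_le (n := m + 1) (k := r') h'.1 (by rw [Nat.succ_mul]; exact h'.2)]
  let A : ℕ → Set Ω := fun r => ⋂ s ∈ B r, {ω | x s.1 ω s.2 = 1}
  have hA : ∀ r, MeasurableSet (A r) := fun r =>
    Finset.measurableSet_biInter _ fun s _ =>
      hx.measurable s.1 s.2 s.2.2 (measurableSet_singleton 1)
  have hμ : ∀ r, μ (A r) = ENNReal.ofReal q ^ ((m + 1) * Fintype.card E) := fun r => by
    rw [← hB r]
    exact hx.measure_biInter (B r)
  -- An intersection of the `A r` is again a finite set of active links, whose probability depends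
  -- only on its size; sizes of disjoint blocks add.
  have hind : iIndepSet A μ := by
    refine (iIndepSet_iff_meas_biInter hA).2 fun S => ?_
    have hU : ⋂ r ∈ S, A r = ⋂ s ∈ S.biUnion B, {ω | x s.1 ω s.2 = 1} := by
      rw [Finset.set_biInter_biUnion]
    rw [hU, hx.measure_biInter, Finset.card_biUnion fun r _ r' _ h => hdisj r r' h,
      ← Finset.prod_pow_eq_pow_sum]
    exact Finset.prod_congr rfl fun r _ => (hx.measure_biInter (B r)).symm
  have hsum : ∑' r, μ (A r) = ⊤ := by
    simp only [hμ]
    exact ENNReal.tsum_const_eq_top_of_ne_zero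
      (pow_ne_zero _ (ENNReal.ofReal_pos.2 hq).ne')
  have hlim := measure_limsup_eq_one hA hind hsum
  have hae : ∀ᵐ ω ∂μ, ω ∈ limsup A atTop :=
    (prob_compl_eq_zero_iff (MeasurableSet.measurableSet_limsup hA)).2 hlim
  filter_upwards [hae] with ω hω
  rw [mem_limsup_iff_frequently_mem] at hω
  -- Block `r` starts at time `r * (m + 1)`, which tends to infinity with `r`.
  refine Tendsto.frequently (tendsto_id.atTop_mul_const' m.succ_pos) (hω.mono fun r hr => ?_)
  intro t ht e he
  exact Set.mem_iInter₂.1 hr (r * (m + 1) + t, ⟨e, he⟩) (by simp [B]; omega)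

theorem IsIIDLinks.ae_tendsto_nodeValue [IsProbabilityMeasure μ]
    (hE : IsCommGraph E) (hx : IsIIDLinks μ E q x)
    (hq₀ : 0 ≤ q) (hq₁ : q ≤ 1) {y₀ : Fin n → ℝ} (hy₀ : ∑ i, y₀ i = 0) :
    ∀ᵐ ω ∂μ, Tendsto (nodeValue E (fun m => x m ω) y₀) atTop (𝓝 0) := by
  rcases hq₀.eq_or_lt with rfl | hq
  · filter_upwards [hx.ae_eq_zero] with ω hω
    exact tendsto_nodeValue_of_forall_eq_zero hω y₀
  · obtain ⟨m, hm⟩ := exists_window_tendsto_nodeValue hE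
    filter_upwards [hx.ae_eq_one_or_eq_zero hq₀ hq₁, hx.ae_frequently_window hq m] with ω h1 h2
    exact hm _ h1 h2 y₀ hy₀

end Probability

end RobustRatio

theorem mainTheorem2 {n : ℕ} (E : Finset (Fin n × Fin n)) (hE : RobustRatio.IsCommGraph E)
    {Ω : Type*} [MeasurableSpace Ω] (μ : Measure Ω) [IsProbabilityMeasure μ]
    (q : ℝ) (hq₀ : 0 ≤ q) (hq₁ : q ≤ 1)
    (x : ℕ → Ω → Fin n × Fin n → ℝ) (hx : RobustRatio.IsIIDLinks μ E q x)
    (y₀ z₀ : Fin n → ℝ) (hy₀ : ∑ j, y₀ j ≠ 0)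
    (α : ℝ) (hα : α = (∑ j, z₀ j) / ∑ j, y₀ j)
    (y z v : ℕ → Ω → Fin n → ℝ)
    (hy : ∀ k ω, y k ω = RobustRatio.nodeValue E (fun m => x m ω) y₀ k)
    (hz : ∀ k ω, z k ω = RobustRatio.nodeValue E (fun m => x m ω) z₀ k)
    (hv : ∀ k ω, v k ω = z k ω - α • y k ω) :
    (∀ᵐ ω ∂μ, Tendsto (fun k => ‖v k ω‖) atTop (𝓝 0)) ∧
      ∀ j, ∀ᵐ ω ∂μ, Tendsto (fun k => v k ω j) atTop (𝓝 0) := by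
  have hsum : ∑ i, (z₀ - α • y₀) i = 0 := by
    simp only [Pi.sub_apply, Pi.smul_apply, smul_eq_mul, Finset.sum_sub_distrib, ← Finset.mul_sum]
    rw [hα, div_mul_cancel₀ _ hy₀, sub_self]
  have hlim : ∀ᵐ ω ∂μ, Tendsto (fun k => v k ω) atTop (𝓝 0) := by
    filter_upwards [hx.ae_tendsto_nodeValue hE hq₀ hq₁ hsum] with ω hω
    refine hω.congr fun k => ?_
    rw [hv, hz, hy, RobustRatio.nodeValue, RobustRatio.iterate_sub_smul]
    rfl
  refine ⟨hlim.mono fun ω h => by simpa using h.norm, fun j => hlim.mono fun ω h => ?_⟩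
  simpa using tendsto_pi_nhds.1 h j
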